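/- Let $k,n\in\mathbb N$ and let $\mathbb T^k=[-1/2,1/2)^k$. Let $X\subseteq\mathbb T^k$ be a Borel set, equipped with the Borel $\sigma$-algebra and Lebesgue measure. Fields of complex matrices on $X$ are called measurable if all their entries are measurable functions. For $v\in\mathbb R^n$ let $v^\downarrow$ be its rearrangement in non-increasing order, and for $a,b\in\mathbb R^n$ write $a\prec b$ ($a$ is majorized by $b$) if $$\sum_{i=1}^m a_i^\downarrow\le\sum_{i=1}^m b_i^\downarrow\quad(1\le m\le n)\qquad\text{and}\qquad \sum_{i=1}^n a_i=\sum_{i=1}^n b_i .$$ Let $A(\cdot)$ be a measurable field of self-adjoint complex $n\times n$ matrices on $X$, and let $b_1,\dots,b_n:X\to\mathbb R$ be measurable functions such that, for a.e. $x\in X$, $b_1(x)\ge\cdots\ge b_n(x)$ are the eigenvalues of $A(x)$ counted with multiplicity. Let $c_1,\dots,c_n:X\to\mathbb R$ be measurable. The following statements are equivalent: 1. $c(x)=(c_1(x),\dots,c_n(x))\prec b(x)=(b_1(x),\dots,b_n(x))$ for a.e. $x\in X$. 2. There exists a measurable field $U(\cdot)$ of unitary $n\times n$ matrices on $X$ such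 that the main diagonal of $U(x)^*A(x)U(x)$ equals $c(x)$ for a.e. $x\in X$. -/

import Mathlib

open MeasureTheory

/-- The `k`-torus `𝕋^k` with `𝕋 = [-1/2, 1/2)`, as a subset of `ℝ^k`. -/
def torus (k : ℕ) : Set (Fin k → ℝ) :=
  Set.univ.pi fun _ => Set.Ico (-(1 / 2) : ℝ) (1 / 2)

/-- The rearrangement `v↓` of a real vector `v` in non-increasing order. -/
noncomputable def decreasingRearrangement {n : ℕ} (v : Fin n → ℝ) : Fin n → ℝ :=
  v ∘ Tuple.sort (fun i => -v i)

/-- `v↓` is non-increasing; being `v` composed with a permutation, it is what its name says. -/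
theorem decreasingRearrangement_antitone {n : ℕ} (v : Fin n → ℝ) :
    Antitone (decreasingRearrangement v) := fun _ _ h =>
  neg_le_neg_iff.1 (Tuple.monotone_sort (fun i => -v i) h)

/-- `Majorized a b` is `a ≺ b`: the partial sums of `a↓` are at most those of `b↓`,
and `a` and `b` have the same total sum. -/
def Majorized {n : ℕ} (a b : Fin n → ℝ) : Prop :=
  (∀ k : Fin n, ∑ i ∈ Finset.Iic k, decreasingRearrangement a i ≤
      ∑ i ∈ Finset.Iic k, decreasingRearrangement b i) ∧
    ∑ i, a i = ∑ i, b i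

/-- A field of complex matrices is measurable if all its entries are measurable functions. -/
def MeasurableField {X : Type*} [MeasurableSpace X] {n : ℕ}
    (A : X → Matrix (Fin n) (Fin n) ℂ) : Prop :=
  ∀ i j, Measurable fun x => A x i j

/-- `b` lists the eigenvalues of `M`, counting multiplicities, in non-increasing order. -/
def IsOrderedEigenvalues {n : ℕ} (M : Matrix (Fin n) (Fin n) ℂ) (b : Fin n → ℝ) : Prop :=
  Antitone b ∧ M.charpoly.roots = Finset.univ.val.map fun i => (b i : ℂ)

/-! Pointwise this is the Schur–Horn theorem, `majorized_iff_mem_unitaryDiagonals`; what remains is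
to choose the unitary measurably. Schur: in an eigenbasis the diagonal is the spectrum averaged by
the doubly stochastic matrix of `|W i j|²`, and such averages are majorized (`sum_mul_le_sum_Iic`).
Horn: a plane reflection shifts mass from a larger diagonal entry to a smaller one
(`exists_unitary_diag_transfer`), and finitely many shifts lead from the eigenvalues to the sorted
target (`mem_of_partialSums_le`). Selection: the unitaries solving the diagonal equation form a
closed subset of a compact group, depending measurably on `x`. Minimising the real and imaginary
parts of the entries one after another singles out a measurable choice
(`exists_measurable_selection`). -/

/-! ### Measurable selection by successive minimisation -/

section Selection

variable {X K : Type*} [MeasurableSpace X] [TopologicalSpace K] [CompactSpace K]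

/-- Minimising a continuous function over the values of a measurable closed-valued multifunction
gives a measurable minimum and a measurable closed-valued multifunction of minimisers. -/
theorem exists_measurable_argmin {F : X → Set K} (hne : ∀ x, (F x).Nonempty)
    (hcl : ∀ x, IsClosed (F x))
    (hF : ∀ C, IsClosed C → MeasurableSet {x | (F x ∩ C).Nonempty})
    {φ : K → ℝ} (hφ : Continuous φ) :
    ∃ (G : X → Set K) (m : X → ℝ), Measurable m ∧ (∀ x, G x ⊆ F x) ∧ (∀ x, (G x).Nonempty) ∧
      (∀ x, IsClosed (G x)) ∧ (∀ C, IsClosed C → MeasurableSet {x | (G x ∩ C).Nonempty}) ∧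
      ∀ x, ∀ u ∈ G x, φ u = m x := by
  have hmin : ∀ x, ∃ u ∈ F x, ∀ v ∈ F x, φ u ≤ φ v := fun x =>
    (hcl x).isCompact.exists_isMinOn (hne x) hφ.continuousOn
  choose u hu huv using hmin
  have hm : Measurable fun x => φ (u x) := by
    refine measurable_of_Iic fun t => ?_
    convert hF _ (isClosed_Iic.preimage hφ : IsClosed (φ ⁻¹' Set.Iic t)) using 1
    ext x
    exact ⟨fun h => ⟨u x, hu x, h⟩, fun ⟨v, hv, hvt⟩ => (huv x v hv).trans hvt⟩
  refine ⟨fun x => F x ∩ φ ⁻¹' {φ (u x)}, fun x => φ (u x), hm, fun x => Set.inter_subset_left,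
    fun x => ⟨u x, hu x, rfl⟩, fun x => (hcl x).inter (isClosed_singleton.preimage hφ),
    fun C hC => ?_, fun x v hv => hv.2⟩
  -- A minimiser lies in `C` iff `F x ∩ C` meets every sublevel set at a rational level above the
  -- minimum; compactness turns these approximations into an exact minimiser.
  have key : {x | (F x ∩ φ ⁻¹' {φ (u x)} ∩ C).Nonempty} =
      ⋂ q : ℚ, {x | φ (u x) < q}ᶜ ∪ {x | (F x ∩ (C ∩ φ ⁻¹' Set.Iic (q : ℝ))).Nonempty} := by
    ext x
    simp only [Set.mem_iInter, Set.mem_union, Set.mem_compl_iff, Set.mem_ofPred_eq]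
    constructor
    · rintro ⟨v, ⟨hvF, hv⟩, hvC⟩ q
      by_cases hq : φ (u x) < q
      · exact Or.inr ⟨v, hvF, hvC, (Set.mem_singleton_iff.1 hv).trans_le hq.le⟩
      · exact Or.inl hq
    · intro h
      have h' : ∀ q : ℚ, φ (u x) < q → ∃ v ∈ F x ∩ C, φ v ≤ q := fun q hq =>
        let ⟨v, hvF, hvC, hv⟩ := (h q).resolve_left (not_not.2 hq)
        ⟨v, ⟨hvF, hvC⟩, hv⟩
      obtain ⟨q₀, hq₀⟩ := exists_rat_gt (φ (u x))
      obtain ⟨v₀, hv₀, -⟩ := h' q₀ hq₀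
      obtain ⟨w, hw, hmw⟩ := ((hcl x).inter hC).isCompact.exists_isMinOn ⟨v₀, hv₀⟩ hφ.continuousOn
      refine ⟨w, ⟨hw.1, le_antisymm ?_ (huv x w hw.1)⟩, hw.2⟩
      refine le_of_forall_gt_imp_ge_of_dense fun t ht => ?_
      obtain ⟨q, hq, hqt⟩ := exists_rat_btwn ht
      obtain ⟨v, hv, hvq⟩ := h' q hq
      exact ((hmw hv).trans hvq).trans hqt.le
  rw [key]
  exact MeasurableSet.iInter fun q => (measurableSet_lt hm measurable_const).compl.union
    (hF _ (hC.inter (isClosed_Iic.preimage hφ)))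

/-- A measurable closed-valued multifunction into a compact space has a selection along which
finitely many given continuous functions are measurable. -/
theorem exists_measurable_selection {F : X → Set K} (hne : ∀ x, (F x).Nonempty)
    (hcl : ∀ x, IsClosed (F x))
    (hF : ∀ C, IsClosed C → MeasurableSet {x | (F x ∩ C).Nonempty})
    {ι : Type*} [Finite ι] {φ : ι → K → ℝ} (hφ : ∀ i, Continuous (φ i)) :
    ∃ s : X → K, (∀ x, s x ∈ F x) ∧ ∀ i, Measurable fun x => φ i (s x) := by
  classical
  have := Fintype.ofFinite ι
  -- Lexicographic minimisation: each treated `φ i` is constant on `G x` with measurable value, so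
  -- at the end an arbitrary choice of point suffices.
  have aux : ∀ t : Finset ι, ∃ G : X → Set K, (∀ x, G x ⊆ F x) ∧ (∀ x, (G x).Nonempty) ∧
      (∀ x, IsClosed (G x)) ∧ (∀ C, IsClosed C → MeasurableSet {x | (G x ∩ C).Nonempty}) ∧
      ∀ i ∈ t, ∃ m : X → ℝ, Measurable m ∧ ∀ x, ∀ u ∈ G x, φ i u = m x := by
    intro t
    induction t using Finset.induction_on with
    | empty => exact ⟨F, fun x => subset_rfl, hne, hcl, hF, by simp⟩
    | insert i t hi ih =>
      obtain ⟨G, hGF, hGne, hGcl, hGm, hG⟩ := ih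
      obtain ⟨H, m, hm, hHG, hHne, hHcl, hHm, hH⟩ := exists_measurable_argmin hGne hGcl hGm (hφ i)
      refine ⟨H, fun x => (hHG x).trans (hGF x), hHne, hHcl, hHm, fun j hj => ?_⟩
      rcases Finset.mem_insert.1 hj with rfl | hj
      · exact ⟨m, hm, hH⟩
      · obtain ⟨m', hm', h⟩ := hG j hj
        exact ⟨m', hm', fun x u hu => h x u (hHG x hu)⟩
  obtain ⟨G, hGF, hGne, -, -, hG⟩ := aux Finset.univ
  choose s hs using hGne
  refine ⟨s, fun x => hGF x (hs x), fun i => ?_⟩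
  obtain ⟨m, hm, h⟩ := hG i (Finset.mem_univ i)
  simpa only [h _ _ (hs _)] using hm

end Selection

/-! ### The pointwise Schur–Horn theorem -/

section SchurHorn

open Matrix

variable {n : ℕ}

/-- The real vectors that occur as main diagonals of matrices unitarily equivalent to `M`. -/
def unitaryDiagonals (M : Matrix (Fin n) (Fin n) ℂ) : Set (Fin n → ℝ) :=
  {d | ∃ U ∈ Matrix.unitaryGroup (Fin n) ℂ, Matrix.diag (Uᴴ * M * U) = fun j => (d j : ℂ)}

theorem submatrix_id_perm_mem_unitaryGroup {U : Matrix (Fin n) (Fin n) ℂ}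
    (hU : U ∈ Matrix.unitaryGroup (Fin n) ℂ) (σ : Equiv.Perm (Fin n)) :
    U.submatrix id σ ∈ Matrix.unitaryGroup (Fin n) ℂ := by
  rw [mem_unitaryGroup_iff', star_eq_conjTranspose] at hU ⊢
  have h : (U.submatrix id σ)ᴴ * U.submatrix id σ = (Uᴴ * U).submatrix σ σ := by
    ext
    simp [Matrix.mul_apply]
  rw [h, hU, submatrix_one_equiv]

theorem comp_perm_mem_unitaryDiagonals {M : Matrix (Fin n) (Fin n) ℂ} {d : Fin n → ℝ}
    (hd : d ∈ unitaryDiagonals M) (σ : Equiv.Perm (Fin n)) : d ∘ σ ∈ unitaryDiagonals M := by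
  obtain ⟨U, hU, h⟩ := hd
  refine ⟨U.submatrix id σ, submatrix_id_perm_mem_unitaryGroup hU σ, ?_⟩
  ext j
  simpa [Matrix.mul_apply] using congrFun h (σ j)

/-- Supplies the phase of the plane reflection: with `z` an off-diagonal entry, the cross terms in
the new diagonal cancel. -/
theorem exists_unit_re_mul_eq_zero (z : ℂ) : ∃ w : ℂ, w * star w = 1 ∧ (w * z).re = 0 := by
  rcases eq_or_ne z 0 with rfl | hz
  · exact ⟨1, by simp, by simp⟩
  · have hz' : (‖z‖ : ℂ) ≠ 0 := by simpa using hz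
    have hzz : z * (starRingEnd ℂ) z = (‖z‖ : ℂ) ^ 2 := Complex.mul_conj' z
    refine ⟨Complex.I * star z / ‖z‖, ?_, ?_⟩
    · simp only [star_div₀, star_mul', Complex.star_def, Complex.conj_I, Complex.conj_ofReal,
        Complex.conj_conj]
      field_simp
      linear_combination hzz - z * (starRingEnd ℂ) z * Complex.I_sq
    · have : Complex.I * star z / ‖z‖ * z = Complex.I * ((‖z‖ : ℝ) : ℂ) := by
        simp only [Complex.star_def]
        field_simp
        linear_combination hzz
      rw [this]
      simp

/-- Conjugating a Hermitian matrix by a suitable plane reflection moves an amount `δ` from the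
`i`-th to the `j`-th diagonal entry. -/
theorem exists_unitary_diag_transfer {M : Matrix (Fin n) (Fin n) ℂ} (hM : M.IsHermitian)
    {d : Fin n → ℝ} (hd : M.diag = fun j => (d j : ℂ)) {i j : Fin n} (hij : i ≠ j) {δ : ℝ}
    (h0 : 0 ≤ δ) (h1 : δ ≤ d i - d j) :
    ∃ U ∈ Matrix.unitaryGroup (Fin n) ℂ,
      Matrix.diag (Uᴴ * M * U) = fun k => ((d + Pi.single j δ - Pi.single i δ : Fin n → ℝ) k : ℂ) := by
  -- Without cross terms the new `i`-th entry is `r² d i + s² d j = d i - s² (d i - d j)`, which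
  -- dictates `s`.
  obtain ⟨r, s, hrs, hδ⟩ : ∃ r s : ℝ, r ^ 2 + s ^ 2 = 1 ∧ s ^ 2 * (d i - d j) = δ := by
    rcases eq_or_ne (d i - d j) 0 with h | h
    · exact ⟨1, 0, by simp, by rw [h] at h1 ⊢; linarith⟩
    · have hpos : 0 < d i - d j := lt_of_le_of_ne (h0.trans h1) h.symm
      have ht : 0 ≤ δ / (d i - d j) := div_nonneg h0 hpos.le
      have ht1 : δ / (d i - d j) ≤ 1 := (div_le_one hpos).2 h1
      refine ⟨√(1 - δ / (d i - d j)), √(δ / (d i - d j)), ?_, ?_⟩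
      · rw [Real.sq_sqrt ht, Real.sq_sqrt (by linarith)]; ring
      · rw [Real.sq_sqrt ht]; field_simp
  obtain ⟨w, hw, hwz⟩ := exists_unit_re_mul_eq_zero (M i j)
  rw [Complex.star_def] at hw
  have hMii : M i i = d i := congrFun hd i
  have hMjj : M j j = d j := congrFun hd j
  have hMji : M j i = star (M i j) := (hM.apply j i).symm
  have hwz' : w * M i j + (starRingEnd ℂ) w * (starRingEnd ℂ) (M i j) = 0 := by
    have := Complex.add_conj (w * M i j)
    rw [hwz] at this
    simpa using this
  have hrs' : (r : ℂ) ^ 2 + (s : ℂ) ^ 2 = 1 := by exact_mod_cast hrs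
  have hδ' : (s : ℂ) ^ 2 * (d i - d j) = δ := by exact_mod_cast hδ
  let v : Fin n → Fin n → ℂ := fun k =>
    if k = i then Pi.single i (r : ℂ) + Pi.single j (s * w)
    else if k = j then Pi.single i (s * star w) - Pi.single j (r : ℂ)
    else Pi.single k 1
  have hvi : v i = Pi.single i (r : ℂ) + Pi.single j (s * w) := if_pos rfl
  have hvj : v j = Pi.single i (s * star w) - Pi.single j (r : ℂ) := by simp [v, hij.symm]
  have hvk : ∀ k, k ≠ i → k ≠ j → v k = Pi.single k 1 := fun k h h' => by simp [v, h, h']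
  have hdiag : ∀ k l, ((of fun a b => v b a)ᴴ * M * (of fun a b => v b a)) k l =
      star (v k) ⬝ᵥ M *ᵥ v l := by
    intro k l
    rw [Matrix.mul_assoc]
    rfl
  refine ⟨of fun a b => v b a, ?_, ?_⟩
  · rw [mem_unitaryGroup_iff', star_eq_conjTranspose]
    ext k l
    have : ((of fun a b => v b a)ᴴ * (of fun a b => v b a)) k l = star (v k) ⬝ᵥ v l := rfl
    rw [this]
    by_cases hki : k = i
    · subst hki
      by_cases hlk : l = k
      · subst hlk
        simp [hvi, hij, hij.symm]
        linear_combination hrs' + (s : ℂ) ^ 2 * hw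
      by_cases hlj : l = j
      · subst hlj
        simp [hvi, hvj, hij, hij.symm]
        ring
      · simp [hvi, hvk l hlk hlj, hlk, hlj, Ne.symm hlk]
    by_cases hkj : k = j
    · subst hkj
      by_cases hlk : l = k
      · subst hlk
        simp [hvj, hij, hij.symm]
        linear_combination hrs' + (s : ℂ) ^ 2 * hw
      by_cases hli : l = i
      · subst hli
        simp [hvi, hvj, hij, hij.symm]
        ring
      · simp [hvj, hvk l hli hlk, hlk, hli, Ne.symm hlk]
    · by_cases hli : l = i
      · subst hli
        simp [hvi, hvk k hki hkj, hki, hkj]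
      by_cases hlj : l = j
      · subst hlj
        simp [hvj, hvk k hki hkj, hki, hkj]
      · simp [hvk l hli hlj, hvk k hki hkj, Matrix.one_apply, Pi.single_apply, eq_comm]
  · ext k
    rw [diag_apply, hdiag]
    by_cases hki : k = i
    · subst hki
      simp [hvi, hij, mulVec_add, hMii, hMjj, hMji]
      linear_combination d k * hrs' + r * s * hwz' + (s : ℂ) ^ 2 * d j * hw - hδ'
    by_cases hkj : k = j
    · subst hkj
      simp [hvj, hij.symm, mulVec_sub, hMii, hMjj, hMji]
      linear_combination d k * hrs' - r * s * hwz' + (s : ℂ) ^ 2 * d i * hw + hδ'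
    · simp [hvk k hki hkj, hki, hkj]
      exact congrFun hd k

theorem transfer_mem_unitaryDiagonals {M : Matrix (Fin n) (Fin n) ℂ} (hM : M.IsHermitian)
    {d : Fin n → ℝ} (hd : d ∈ unitaryDiagonals M) {i j : Fin n} (hij : i ≠ j) {δ : ℝ}
    (h0 : 0 ≤ δ) (h1 : δ ≤ d i - d j) :
    d + Pi.single j δ - Pi.single i δ ∈ unitaryDiagonals M := by
  obtain ⟨U, hU, h⟩ := hd
  obtain ⟨V, hV, h'⟩ :=
    exists_unitary_diag_transfer (isHermitian_conjTranspose_mul_mul U hM) h hij h0 h1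
  exact ⟨U * V, mul_mem hU hV, by rw [← h']; simp only [conjTranspose_mul, Matrix.mul_assoc]⟩

/-- A set of vectors stable under transfers from larger to smaller entries contains every
non-increasing vector whose partial sums are dominated by those of a member. -/
theorem mem_of_partialSums_le {S : Set (Fin n → ℝ)}
    (hS : ∀ d ∈ S, ∀ i j : Fin n, i ≠ j → ∀ δ : ℝ, 0 ≤ δ → δ ≤ d i - d j →
      d + Pi.single j δ - Pi.single i δ ∈ S)
    {c d : Fin n → ℝ} (hc : Antitone c) (hd : d ∈ S)
    (hle : ∀ k, ∑ i ∈ Finset.Iic k, c i ≤ ∑ i ∈ Finset.Iic k, d i) (heq : ∑ i, c i = ∑ i, d i) :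
    c ∈ S := by
  induction hN : (Finset.univ.filter fun i => c i ≠ d i).card using Nat.strong_induction_on
    generalizing d with
  | _ N ih =>
    by_cases hcd : c = d
    · exact hcd ▸ hd
    have hex : ∃ k, d k < c k := by
      by_contra! h
      exact hcd (funext fun i => (Finset.sum_eq_sum_iff_of_le fun i _ => h i).1 heq i
        (Finset.mem_univ i))
    -- At the first deficit `k`, the partial sum up to `k` forces a strict surplus at some earlier
    -- `j`.
    obtain ⟨k, hk, hkmin⟩ : ∃ k, d k < c k ∧ ∀ l < k, c l ≤ d l := by
      obtain ⟨k, hk⟩ := exists_minimal_of_wellFoundedLT (fun k => d k < c k) hex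
      exact ⟨k, hk.1, fun l hl => not_lt.1 fun h => (hk.2 h hl.le).not_gt hl⟩
    obtain ⟨j, hjk, hj⟩ : ∃ j < k, c j < d j := by
      by_contra! h
      refine (hle k).not_gt (Finset.sum_lt_sum (fun i hi => ?_) ⟨k, by simp, hk⟩)
      rcases (Finset.mem_Iic.1 hi).lt_or_eq with h' | rfl
      · exact h i h'
      · exact hk.le
    -- The largest shift overshooting neither target; it makes `d` agree with `c` at `j` or `k`, so
    -- the number of disagreements drops.
    set δ := min (d j - c j) (c k - d k) with hδ
    have hδ0 : 0 < δ := lt_min (by linarith) (by linarith)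
    have hδ1 : δ ≤ d j - c j := min_le_left _ _
    have hδ2 : δ ≤ c k - d k := min_le_right _ _
    -- Monotonicity of `c` alone gives `δ ≤ d j - d k`; `d` need not stay sorted.
    have hckj : c k ≤ c j := hc hjk.le
    have hj' : (d + Pi.single k δ - Pi.single j δ : Fin n → ℝ) j = d j - δ := by simp [hjk.ne]
    have hk' : (d + Pi.single k δ - Pi.single j δ : Fin n → ℝ) k = d k + δ := by simp [hjk.ne']
    have ho : ∀ i, i ≠ j → i ≠ k → (d + Pi.single k δ - Pi.single j δ : Fin n → ℝ) i = d i := fun i h h' => by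
      simp [h, h']
    have hsum : ∀ t : Finset (Fin n), ∑ i ∈ t, (d + Pi.single k δ - Pi.single j δ : Fin n → ℝ) i =
        ∑ i ∈ t, d i + (if k ∈ t then δ else 0) - (if j ∈ t then δ else 0) := fun t => by
      simp [Finset.sum_add_distrib, Finset.sum_sub_distrib, Finset.sum_pi_single']
    refine ih _ ?_ (hS d hd j k hjk.ne δ hδ0.le (by linarith)) (fun m => ?_) ?_ rfl
    · rw [← hN]
      refine Finset.card_lt_card ⟨fun i hi => ?_, fun hsub => ?_⟩
      · simp only [Finset.mem_filter, Finset.mem_univ, true_and] at hi ⊢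
        rcases eq_or_ne i j with rfl | hij
        · exact hj.ne
        rcases eq_or_ne i k with rfl | hik
        · exact hk.ne'
        rwa [ho i hij hik] at hi
      · have h1 := hsub (Finset.mem_filter.2 ⟨Finset.mem_univ j, hj.ne⟩)
        have h2 := hsub (Finset.mem_filter.2 ⟨Finset.mem_univ k, hk.ne'⟩)
        simp only [Finset.mem_filter, Finset.mem_univ, true_and, hj', hk'] at h1 h2
        rcases min_choice (d j - c j) (c k - d k) with h | h
        · exact h1 (by rw [hδ, h]; ring)
        · exact h2 (by rw [hδ, h]; ring)
    · rw [hsum]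
      by_cases hjm : j ≤ m
      · by_cases hkm : k ≤ m
        · simpa [hjm, hkm] using hle m
        -- For `j ≤ m < k` the partial sum loses `δ`, but all surpluses before `k` are nonnegative
        -- and the one at `j` is at least `δ`.
        · have : ∑ i ∈ Finset.Iic m, Pi.single j δ i ≤ ∑ i ∈ Finset.Iic m, (d i - c i) := by
            refine Finset.sum_le_sum fun i hi => ?_
            rcases eq_or_ne i j with rfl | hij
            · simpa using hδ1
            · simpa [hij] using hkmin i ((Finset.mem_Iic.1 hi).trans_lt (not_le.1 hkm))
          simp [Finset.sum_pi_single', hjm] at this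
          simp [hjm, hkm]
          linarith
      · have hkm : ¬ k ≤ m := fun h => hjm (hjk.le.trans h)
        simpa [hjm, hkm] using hle m
    · rw [hsum]
      simpa using heq

theorem decreasingRearrangement_of_antitone {b : Fin n → ℝ} (hb : Antitone b) :
    decreasingRearrangement b = b := by
  have h : Tuple.sort (fun i => -b i) = Equiv.refl _ :=
    Tuple.sort_eq_refl_iff_monotone.2 fun _ _ h => neg_le_neg (hb h)
  rw [decreasingRearrangement, h]
  rfl

theorem IsOrderedEigenvalues.exists_unitary {M : Matrix (Fin n) (Fin n) ℂ} {b : Fin n → ℝ}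
    (hb : IsOrderedEigenvalues M b) (hM : M.IsHermitian) :
    ∃ V ∈ Matrix.unitaryGroup (Fin n) ℂ, Vᴴ * M * V = diagonal fun i => (b i : ℂ) := by
  set e := hM.eigenvalues with he
  obtain ⟨σ, hσ⟩ : ∃ σ : Equiv.Perm (Fin n), b = e ∘ σ := by
    refine ⟨Tuple.sort fun i => -e i, ?_⟩
    have hanti : Antitone (e ∘ Tuple.sort fun i => -e i) := decreasingRearrangement_antitone e
    have hroots := hb.2.symm.trans hM.roots_charpoly_eq_eigenvalues
    have hmap : Finset.univ.val.map b = Finset.univ.val.map e := by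
      apply Multiset.map_injective Complex.ofReal_injective
      rw [Multiset.map_map, Multiset.map_map]
      exact hroots
    rw [Fin.univ_val_map, Fin.univ_val_map, Multiset.coe_eq_coe] at hmap
    refine List.ofFn_injective ((hmap.trans (Equiv.Perm.ofFn_comp_perm _ e).symm).eq_of_pairwise'
      (r := (· ≥ ·)) ?_ ?_)
    · exact hb.1.sortedGE_ofFn.pairwise
    · exact hanti.sortedGE_ofFn.pairwise
  have hdiag := hM.conjStarAlgAut_star_eigenvectorUnitary
  rw [Unitary.conjStarAlgAut_star_apply] at hdiag
  have h := (hM.eigenvectorUnitary).2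
  set V := (hM.eigenvectorUnitary : Matrix (Fin n) (Fin n) ℂ)
  refine ⟨V.submatrix id σ, submatrix_id_perm_mem_unitaryGroup h σ, ?_⟩
  have h2 : (V.submatrix id σ)ᴴ * M * V.submatrix id σ = (Vᴴ * M * V).submatrix σ σ := by
    ext
    simp [Matrix.mul_apply]
  rw [h2, ← star_eq_conjTranspose]
  erw [hdiag]
  rw [submatrix_diagonal_equiv, hσ]
  rfl

/-- A weighted sum of a non-increasing sequence, with weights in `[0, 1]` of total mass `k + 1`, is
at most the sum of the first `k + 1` terms. -/
theorem sum_mul_le_sum_Iic {b w : Fin n → ℝ} (hb : Antitone b) (h0 : ∀ i, 0 ≤ w i)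
    (h1 : ∀ i, w i ≤ 1) (k : Fin n) (hw : ∑ i, w i = (Finset.Iic k).card) :
    ∑ i, w i * b i ≤ ∑ i ∈ Finset.Iic k, b i := by
  have hsum : ∑ i, (w i - if i ≤ k then 1 else 0) = 0 := by
    rw [Finset.sum_sub_distrib, hw]
    simp [← Finset.filter_ge_eq_Iic]
  -- The weight differences sum to zero, so subtracting `b k` changes nothing and fixes the sign of
  -- every term.
  have hle : ∑ i, (w i - if i ≤ k then 1 else 0) * (b i - b k) ≤ 0 := by
    refine Finset.sum_nonpos fun i _ => ?_
    split_ifs with h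
    · exact mul_nonpos_of_nonpos_of_nonneg (by linarith [h1 i]) (by linarith [hb h])
    · exact mul_nonpos_of_nonneg_of_nonpos (by linarith [h0 i]) (by linarith [hb (not_le.1 h).le])
  have hexp : ∑ i, (w i - if i ≤ k then 1 else 0) * (b i - b k) =
      ∑ i, w i * b i - ∑ i ∈ Finset.Iic k, b i := by
    simp only [mul_sub, Finset.sum_sub_distrib (f := fun i => (w i - if i ≤ k then 1 else 0) * b i),
      ← Finset.sum_mul, hsum, zero_mul, sub_zero]
    simp only [sub_mul, Finset.sum_sub_distrib, ite_mul, one_mul, zero_mul,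
      ← Finset.filter_ge_eq_Iic, Finset.sum_filter]
  linarith

/-- **Schur–Horn theorem.** -/
theorem majorized_iff_mem_unitaryDiagonals {M : Matrix (Fin n) (Fin n) ℂ} (hM : M.IsHermitian)
    {b c : Fin n → ℝ} (hb : IsOrderedEigenvalues M b) :
    Majorized c b ↔ c ∈ unitaryDiagonals M := by
  obtain ⟨V, hV, hVM⟩ := hb.exists_unitary hM
  constructor
  · rintro ⟨hle, heq⟩
    have hbM : b ∈ unitaryDiagonals M := ⟨V, hV, by rw [hVM, diag_diagonal]⟩
    rw [decreasingRearrangement_of_antitone hb.1] at hle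
    have hmem : decreasingRearrangement c ∈ unitaryDiagonals M := by
      refine mem_of_partialSums_le (fun d hd i j hij δ h0 h1 =>
        transfer_mem_unitaryDiagonals hM hd hij h0 h1) (decreasingRearrangement_antitone c) hbM
        hle ?_
      rw [← heq]
      exact Equiv.sum_comp (Tuple.sort fun i => -c i) c
    convert comp_perm_mem_unitaryDiagonals hmem (Tuple.sort fun i => -c i).symm using 1
    ext i
    simp [decreasingRearrangement]
  · intro hc
    set σ := Tuple.sort fun i => -c i
    obtain ⟨U, hU, hUc⟩ := comp_perm_mem_unitaryDiagonals hc σ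
    have hUVM : Uᴴ * M * U = (Vᴴ * U)ᴴ * diagonal (fun i => (b i : ℂ)) * (Vᴴ * U) := by
      have hVV : V * Vᴴ = 1 := mem_unitaryGroup_iff.1 hV
      rw [← hVM, conjTranspose_mul, conjTranspose_conjTranspose]
      simp only [← Matrix.mul_assoc]
      rw [Matrix.mul_assoc Uᴴ V, hVV, Matrix.mul_one]
      rw [Matrix.mul_assoc (Uᴴ * M) V, hVV, Matrix.mul_one]
    have hW : Vᴴ * U ∈ Matrix.unitaryGroup (Fin n) ℂ := mul_mem (Unitary.star_mem hV) hU
    set W := Vᴴ * U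
    have hcol : ∀ j, ∑ i, Complex.normSq (W i j) = 1 := fun j => by
      have := congrFun (congrFun (mem_unitaryGroup_iff'.1 hW) j) j
      simp only [Matrix.mul_apply, star_apply, Complex.star_def, ← Complex.normSq_eq_conj_mul_self,
        one_apply_eq] at this
      exact_mod_cast this
    have hrow : ∀ i, ∑ j, Complex.normSq (W i j) = 1 := fun i => by
      have := congrFun (congrFun (mem_unitaryGroup_iff.1 hW) i) i
      simp only [Matrix.mul_apply, star_apply, Complex.star_def, Complex.mul_conj,
        one_apply_eq] at this
      exact_mod_cast this
    have hcW : ∀ j, c (σ j) = ∑ i, Complex.normSq (W i j) * b i := fun j => by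
      have := congrFun hUc j
      rw [hUVM] at this
      rw [diag_apply, Matrix.mul_apply] at this
      simp only [mul_diagonal, conjTranspose_apply] at this
      have h2 : ((∑ i, Complex.normSq (W i j) * b i : ℝ) : ℂ) = c (σ j) := by
        rw [← Function.comp_apply (f := c), ← this]
        push_cast
        refine Finset.sum_congr rfl fun i _ => ?_
        rw [Complex.normSq_eq_conj_mul_self, Complex.star_def]
        ring
      exact_mod_cast h2.symm
    have hsw : ∀ t : Finset (Fin n), ∑ j ∈ t, c (σ j) =
        ∑ i, (∑ j ∈ t, Complex.normSq (W i j)) * b i := fun t => by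
      simp only [hcW, Finset.sum_mul]
      exact Finset.sum_comm
    refine ⟨fun k => ?_, ?_⟩
    · rw [decreasingRearrangement_of_antitone hb.1]
      refine (hsw _).trans_le (sum_mul_le_sum_Iic hb.1
        (fun i => Finset.sum_nonneg fun j _ => Complex.normSq_nonneg _) (fun i => ?_) k ?_)
      · rw [← hrow i]
        exact Finset.sum_le_sum_of_subset_of_nonneg (Finset.subset_univ _)
          fun j _ _ => Complex.normSq_nonneg _
      · rw [Finset.sum_comm]
        simp [hcol]
    · rw [← Equiv.sum_comp σ, hsw]
      simp [hrow]

end SchurHorn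

/-! ### Measurable choice of the unitary -/

instance compactSpace_unitaryGroup (n : ℕ) : CompactSpace (Matrix.unitaryGroup (Fin n) ℂ) := by
  refine isCompact_iff_compactSpace.1 (IsCompact.of_isClosed_subset
    (isCompact_univ_pi fun _ => isCompact_univ_pi fun _ => isCompact_closedBall (0 : ℂ) 1) ?_ ?_)
  · exact isClosed_unitary
  · intro U hU i _ j _
    simpa using entry_norm_bound_of_unitary hU i j

/-- A measurable pointwise solvable diagonal problem has a measurable unitary solution. -/
theorem exists_measurableField_unitary {X : Type*} [MeasurableSpace X] {n : ℕ}
    {A : X → Matrix (Fin n) (Fin n) ℂ} (hA : MeasurableField A)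
    {c : X → Fin n → ℝ} (hc : ∀ j, Measurable fun x => c x j) :
    ∃ U : X → Matrix.unitaryGroup (Fin n) ℂ,
      MeasurableField (fun x => (U x : Matrix (Fin n) (Fin n) ℂ)) ∧
      ∀ x, c x ∈ unitaryDiagonals (A x) →
        Matrix.diag ((U x : Matrix (Fin n) (Fin n) ℂ).conjTranspose * A x *
          (U x : Matrix (Fin n) (Fin n) ℂ)) = fun j => (c x j : ℂ) := by
  classical
  let P := (Fin n → Fin n → ℂ) × (Fin n → ℝ)
  let R : Set (P × Matrix.unitaryGroup (Fin n) ℂ) := {q | Matrix.diag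
    ((q.2 : Matrix (Fin n) (Fin n) ℂ).conjTranspose * Matrix.of q.1.1 *
      (q.2 : Matrix (Fin n) (Fin n) ℂ)) = fun j => (q.1.2 j : ℂ)}
  have hR : IsClosed R := by
    refine isClosed_eq ?_ (continuous_pi fun j =>
      Complex.continuous_ofReal.comp ((continuous_apply j).comp continuous_fst.snd))
    have h1 : Continuous fun q : P × Matrix.unitaryGroup (Fin n) ℂ =>
      (q.2 : Matrix (Fin n) (Fin n) ℂ) := by fun_prop
    have h2 : Continuous fun q : P × Matrix.unitaryGroup (Fin n) ℂ =>
      (Matrix.of q.1.1 : Matrix (Fin n) (Fin n) ℂ) := continuous_fst.fst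
    exact ((h1.matrix_conjTranspose.matrix_mul h2).matrix_mul h1).matrix_diag
  let p : X → P := fun x => (A x, c x)
  have hp : Measurable p := by
    refine Measurable.prodMk ?_ (measurable_pi_iff.2 hc)
    exact measurable_pi_iff.2 fun i => measurable_pi_iff.2 fun j => hA i j
  let F₀ : X → Set (Matrix.unitaryGroup (Fin n) ℂ) := fun x => {U | (p x, U) ∈ R}
  have hF₀cl : ∀ x, IsClosed (F₀ x) := fun x => hR.preimage (by fun_prop)
  have hF₀ : ∀ C, IsClosed C → MeasurableSet {x | (F₀ x ∩ C).Nonempty} := fun C hC => by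
    -- Projection along the compact group is closed, so the solvable data form a closed set, pulled
    -- back by the measurable `p`.
    have hcl := isClosedMap_fst_of_compactSpace _ (hR.inter (hC.preimage continuous_snd))
    convert hp hcl.measurableSet using 1
    ext x
    constructor
    · rintro ⟨U, hU, hUC⟩
      exact ⟨(p x, U), ⟨hU, hUC⟩, rfl⟩
    · rintro ⟨⟨q, U⟩, ⟨hU, hUC⟩, rfl⟩
      exact ⟨U, hU, hUC⟩
  have hD : MeasurableSet {x | (F₀ x).Nonempty} := by simpa using hF₀ _ isClosed_univ
  -- Where no solution exists any unitary is allowed, keeping the values nonempty.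
  let F : X → Set (Matrix.unitaryGroup (Fin n) ℂ) := fun x =>
    if (F₀ x).Nonempty then F₀ x else Set.univ
  obtain ⟨U, hU, hUm⟩ := exists_measurable_selection (F := F)
    (ι := (Fin n × Fin n) ⊕ (Fin n × Fin n))
    (φ := Sum.elim (fun ij V => ((V : Matrix (Fin n) (Fin n) ℂ) ij.1 ij.2).re)
      (fun ij V => ((V : Matrix (Fin n) (Fin n) ℂ) ij.1 ij.2).im))
    (fun x => by
      by_cases h : (F₀ x).Nonempty
      · simp [F, h]
      · simp [F, h])
    (fun x => by
      by_cases h : (F₀ x).Nonempty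
      · simpa [F, h] using hF₀cl x
      · simp [F, h])
    (fun C hC => by
      have : {x | (F x ∩ C).Nonempty} = {x | (F₀ x ∩ C).Nonempty} ∪
          ({x | (F₀ x).Nonempty}ᶜ ∩ {_x | C.Nonempty}) := by
        ext x
        by_cases h : (F₀ x).Nonempty
        · simp [F, h]
        · simp [F, Set.not_nonempty_iff_eq_empty.1 h]
      rw [this]
      exact (hF₀ C hC).union (hD.compl.inter (MeasurableSet.const _)))
    (by
      have h : ∀ i j, Continuous fun V : Matrix.unitaryGroup (Fin n) ℂ =>
          (V : Matrix (Fin n) (Fin n) ℂ) i j := fun i j =>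
        continuous_subtype_val.matrix_elem i j
      rintro (ij | ij)
      · exact Complex.continuous_re.comp (h _ _)
      · exact Complex.continuous_im.comp (h _ _))
  refine ⟨U, fun i j => ?_, fun x hx => ?_⟩
  · exact measurable_of_re_im (hUm (Sum.inl (i, j))) (hUm (Sum.inr (i, j)))
  · obtain ⟨V, hV, hVc⟩ := hx
    have hne : (F₀ x).Nonempty := ⟨⟨V, hV⟩, hVc⟩
    have := hU x
    simp only [F, if_pos hne] at this
    exact this

theorem theorem5p1 (k n : ℕ) (X : Set (Fin k → ℝ)) (hX : MeasurableSet X) (hXT : X ⊆ torus k)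
    (A : X → Matrix (Fin n) (Fin n) ℂ) (hA : MeasurableField A)
    (hAsa : ∀ x, (A x).IsHermitian)
    (b : X → Fin n → ℝ) (hb : ∀ j, Measurable fun x => b x j)
    (hAb : ∀ᵐ x ∂(volume.comap ((↑) : X → Fin k → ℝ)), IsOrderedEigenvalues (A x) (b x))
    (c : X → Fin n → ℝ) (hc : ∀ j, Measurable fun x => c x j) :
    (∀ᵐ x ∂(volume.comap ((↑) : X → Fin k → ℝ)), Majorized (c x) (b x)) ↔
      ∃ U : X → Matrix.unitaryGroup (Fin n) ℂ,
        MeasurableField (fun x => (U x : Matrix (Fin n) (Fin n) ℂ)) ∧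
        ∀ᵐ x ∂(volume.comap ((↑) : X → Fin k → ℝ)),
          Matrix.diag ((U x : Matrix (Fin n) (Fin n) ℂ).conjTranspose * A x *
            (U x : Matrix (Fin n) (Fin n) ℂ)) = fun j => (c x j : ℂ) := by
  constructor
  · intro h
    obtain ⟨U, hUm, hU⟩ := exists_measurableField_unitary hA hc
    refine ⟨U, hUm, ?_⟩
    filter_upwards [h, hAb] with x hx hbx
    exact hU x ((majorized_iff_mem_unitaryDiagonals (hAsa x) hbx).1 hx)
  · rintro ⟨U, -, hU⟩
    filter_upwards [hU, hAb] with x hx hbx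
    exact (majorized_iff_mem_unitaryDiagonals (hAsa x) hbx).2 ⟨U x, (U x).2, hx⟩
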